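/- **Transducers.** A query algorithm on a finite-dimensional complex inner product space $\mathcal H=\mathcal H^\circ\oplus(\mathcal H^\uparrow\otimes\mathcal M)$ with input oracle a unitary $O$ on $\mathcal M$ is a product $A(O)=U_Q\widetilde O U_{Q-1}\widetilde O\cdots\widetilde O U_0$, where the $U_t$ are unitaries on $\mathcal H$ independent of $O$ and $\widetilde O=I\oplus(I\otimes O)$. Its Las Vegas query complexity on $\psi\in\mathcal H$ is $L(A,O,\psi)=\sum_{t=1}^{Q}\|\psi_t^\bullet\|^2$, where $\psi_t=U_{t-1}\widetilde O\cdots\widetilde O U_0\psi$ is the state before the $t$-th query and $\psi_t^\bullet$ is its component in $\mathcal H^\uparrow\otimes\mathcal M$. A transducer $S=S(O)$ with public space $\mathcal P$ and private space $\mathcal L$ is a query algorithm on $\mathcal P\oplus\mathcal L$. It transduces $\xi\in\mathcal P$ into $\tau\in\mathcal P$ with catalyst $v\in\mathcal L$ if $S(O)(\xi\oplus v)=\tau\oplus v$; the query complexity of this transduction is $L(S,O,\xi\oplus v)$. **Corollary 4.6.** Let $\mathcal A=\mathbb C^2$ be a qubit, $\mathcal W$ a finite-dimensional complex inner product space, and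 $|0\rangle_{\mathcal W}\in\mathcal W$ a fixed unit vector. Let $X$ be a finite set, and for each $x\in X$ let $p_x\in[0,1]$ with $p_x\neq\frac12$, let $\phi_{x,0},\phi_{x,1}\in\mathcal W$ be unit vectors, and let $O_x$ be a unitary on $\mathcal A\otimes\mathcal W$ such that $$O_x\,|0\rangle_{\mathcal A}|0\rangle_{\mathcal W}=\sqrt{1-p_x}\,|0\rangle_{\mathcal A}|\phi_{x,0}\rangle+\sqrt{p_x}\,|1\rangle_{\mathcal A}|\phi_{x,1}\rangle .$$ Then there exists a single transducer $S$ with public space $\mathbb C^2$, finite-dimensional private space, and input oracle acting on $(\mathcal A\otimes\mathcal W)\oplus(\mathcal A\otimes\mathcal W)$, such that for every $x\in X$ the transducer $S(O_x\oplus O_x^*)$ transduces, exactly and for some catalyst $v_x$, $$|0\rangle\ \text{ into }\ \begin{cases}|0\rangle,&p_x<\tfrac12,\\ |1\rangle,&p_x>\tfrac12,\end{cases}$$ and the query complexity of this transduction (with the catalyst $v_x$) equals $1+\dfrac1{2\delta_x}$, where $\delta_x=\left|\tfrac12-p_x\right|$. -/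

import Mathlib

open scoped TensorProduct

noncomputable section

/-- A quantum query algorithm `U_Q Õ U_{Q-1} Õ ⋯ Õ U_0` on the space `H`, with an input oracle
acting on `M`. The space is decomposed as `H = Hw ⊕ (Hup ⊗ M)` and the oracle acts on the factor
`M` of the second summand only. The unitaries `U t` do not depend on the oracle. All spaces are
meant to be finite-dimensional, so that no completion of `Hup ⊗ M` is needed. -/
structure QueryAlgorithm (H Hw Hup M : Type*)
    [NormedAddCommGroup H] [InnerProductSpace ℂ H]
    [NormedAddCommGroup Hw] [InnerProductSpace ℂ Hw]
    [NormedAddCommGroup Hup] [InnerProductSpace ℂ Hup]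
    [NormedAddCommGroup M] [InnerProductSpace ℂ M] where
  /-- The orthogonal decomposition of the space. -/
  decomp : H ≃ₗᵢ[ℂ] WithLp 2 (Hw × (Hup ⊗[ℂ] M))
  /-- The number of queries. -/
  Q : ℕ
  /-- The input-independent unitaries `U 0, …, U Q`; later entries are not used. -/
  U : ℕ → (H ≃ₗᵢ[ℂ] H)

namespace QueryAlgorithm

variable {H Hw Hup M : Type*}
  [NormedAddCommGroup H] [InnerProductSpace ℂ H]
  [NormedAddCommGroup Hw] [InnerProductSpace ℂ Hw]
  [NormedAddCommGroup Hup] [InnerProductSpace ℂ Hup]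
  [NormedAddCommGroup M] [InnerProductSpace ℂ M]

/-- The query operator `Õ = I ⊕ (I ⊗ O)`. -/
def queryOp (A : QueryAlgorithm H Hw Hup M) (O : M ≃ₗᵢ[ℂ] M) : H ≃ₗᵢ[ℂ] H :=
  (A.decomp.trans
    (LinearIsometryEquiv.withLpProdCongr 2 (LinearIsometryEquiv.refl ℂ Hw) (O.lTensor Hup))).trans
    A.decomp.symm

/-- `A.state O ξ t = U_t Õ U_{t-1} Õ ⋯ Õ U_0 ξ`, the state after `t` queries and `U_t`. For
`t < Q` this is the state right before query number `t + 1`. -/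
def state (A : QueryAlgorithm H Hw Hup M) (O : M ≃ₗᵢ[ℂ] M) (ξ : H) : ℕ → H
  | 0 => A.U 0 ξ
  | t + 1 => A.U (t + 1) (A.queryOp O (A.state O ξ t))

/-- The action `A(O) ξ = U_Q Õ ⋯ Õ U_0 ξ`. -/
def action (A : QueryAlgorithm H Hw Hup M) (O : M ≃ₗᵢ[ℂ] M) (ξ : H) : H :=
  A.state O ξ A.Q

/-- The Las Vegas query complexity `L(A, O, ξ)`: the sum over all queries of the squared norm of
the part of the state to which the input oracle is applied. -/
def lasVegas (A : QueryAlgorithm H Hw Hup M) (O : M ≃ₗᵢ[ℂ] M) (ξ : H) : ℝ :=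
  ∑ t ∈ Finset.range A.Q, ‖(A.decomp (A.state O ξ t)).snd‖ ^ 2

end QueryAlgorithm

/-- A transducer with public space `Hp` and private space `L`, having an input oracle on `M`:
a unitary on `Hp ⊕ L` together with its implementation as a query algorithm. -/
abbrev Transducer (Hp L Hw Hup M : Type*)
    [NormedAddCommGroup Hp] [InnerProductSpace ℂ Hp]
    [NormedAddCommGroup L] [InnerProductSpace ℂ L]
    [NormedAddCommGroup Hw] [InnerProductSpace ℂ Hw]
    [NormedAddCommGroup Hup] [InnerProductSpace ℂ Hup]
    [NormedAddCommGroup M] [InnerProductSpace ℂ M] :=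
  QueryAlgorithm (WithLp 2 (Hp × L)) Hw Hup M

namespace Transducer

variable {Hp L Hw Hup M : Type*}
  [NormedAddCommGroup Hp] [InnerProductSpace ℂ Hp]
  [NormedAddCommGroup L] [InnerProductSpace ℂ L]
  [NormedAddCommGroup Hw] [InnerProductSpace ℂ Hw]
  [NormedAddCommGroup Hup] [InnerProductSpace ℂ Hup]
  [NormedAddCommGroup M] [InnerProductSpace ℂ M]

/-- `S(O)` transduces `ξ` into `τ` with catalyst `v`, i.e. `S(O)` maps `ξ ⊕ v` to `τ ⊕ v`. -/
def TransducesWith (S : Transducer Hp L Hw Hup M) (O : M ≃ₗᵢ[ℂ] M) (ξ τ : Hp) (v : L) : Prop :=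
  QueryAlgorithm.action S O (WithLp.toLp 2 (ξ, v)) = WithLp.toLp 2 (τ, v)

/-- The query complexity of the transducer on `ξ` with catalyst `v`: the Las Vegas query
complexity of its implementation on the initial coupling `ξ ⊕ v`. -/
def queryComplexity (S : Transducer Hp L Hw Hup M) (O : M ≃ₗᵢ[ℂ] M) (ξ : Hp) (v : L) : ℝ :=
  QueryAlgorithm.lasVegas S O (WithLp.toLp 2 (ξ, v))

end Transducer

/-- The space of a qubit. -/
abbrev Qubit : Type := EuclideanSpace ℂ (Fin 2)

/-- The computational basis states `|0⟩` and `|1⟩` of a qubit. -/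
def ket (b : Fin 2) : Qubit := EuclideanSpace.single b (1 : ℂ)

/-- Bidirectional access to `O`: the oracle `O ⊕ O*`. -/
def bidirectional {M : Type*} [NormedAddCommGroup M] [InnerProductSpace ℂ M]
    (O : M ≃ₗᵢ[ℂ] M) : WithLp 2 (M × M) ≃ₗᵢ[ℂ] WithLp 2 (M × M) :=
  LinearIsometryEquiv.withLpProdCongr 2 O O.symm

end

/-! A unitary taking one family of vectors to another exists once their Gram matrices agree, so it
suffices to choose the states around each query (`exists_transducer_of_inner_eq`). Let `z` be the
input to `O x`, `ψ x` its image, `ω x` a unit vector orthogonal to `ψ x` in the span of the two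
branches, and `χ x` its preimage. The catalyst is `f x ⊗ z - g x ⊗ χ x`. Half of the public weight
moves onto `e ⊗ z`; after querying `O x`, the middle unitary flips the sign of `g x` and multiplies
`e` by the sign `s x` of `1/2 - p x`; querying the inverse then restores the catalyst and leaves `s
x` as a phase, which the last unitary turns into the answer.

The middle unitary is the only real constraint. It prescribes the inner products of `f x` and `g y`
for `x`, `y` on opposite sides of `1/2`, as multiples of the Cauchy kernel `1 / (δ x + δ y)`. This
kernel is positive semidefinite, which yields the vectors (`exists_catalyst_vectors`). Each query
costs `1/2 + ‖f x‖² + ‖g x‖² = 1/2 + 1 / (4 δ x)`. -/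

/-! ### Gram matrices and unitaries. -/

/-- In a finite-dimensional space, two families of vectors with the same Gram matrix are related
by a unitary. -/
theorem exists_linearIsometryEquiv_of_inner_eq {E ι : Type*} [NormedAddCommGroup E]
    [InnerProductSpace ℂ E] [FiniteDimensional ℂ E] (u w : ι → E)
    (h : ∀ i j, inner ℂ (u i) (u j) = inner ℂ (w i) (w j)) :
    ∃ U : E ≃ₗᵢ[ℂ] E, ∀ i, U (u i) = w i := by
  set f := Finsupp.linearCombination ℂ u with hf
  set g := Finsupp.linearCombination ℂ w with hg
  have hnorm : ∀ c, ‖g c‖ = ‖f c‖ := by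
    intro c
    have : inner ℂ (g c) (g c) = inner ℂ (f c) (f c) := by
      simp only [hf, hg, Finsupp.linearCombination_apply, Finsupp.sum, sum_inner, inner_sum,
        inner_smul_left, inner_smul_right, h]
    rw [inner_self_eq_norm_sq_to_K, inner_self_eq_norm_sq_to_K] at this
    exact (sq_eq_sq₀ (norm_nonneg _) (norm_nonneg _)).1 (by exact_mod_cast this)
  -- This makes `f c ↦ g c` well defined on the span of `u`.
  have hker : LinearMap.ker f ≤ LinearMap.ker g := by
    intro c hc
    rw [LinearMap.mem_ker] at hc ⊢
    rw [← norm_eq_zero, hnorm, hc, norm_zero]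
  let L : LinearMap.range f →ₗ[ℂ] E :=
    ((LinearMap.ker f).liftQ g hker).comp f.quotKerEquivRange.symm.toLinearMap
  have hL : ∀ c, L ⟨f c, LinearMap.mem_range_self f c⟩ = g c := by
    intro c
    simp [L, LinearMap.quotKerEquivRange_symm_apply_image]
  let Li : LinearMap.range f →ₗᵢ[ℂ] E :=
    ⟨L, by rintro ⟨_, c, rfl⟩; rw [hL, hnorm]; rfl⟩
  refine ⟨Li.extend.toLinearIsometryEquiv rfl, fun i => ?_⟩
  have hi : f (Finsupp.single i 1) = u i := by simp [hf]
  have h1 := Li.extend_apply ⟨f (Finsupp.single i 1), LinearMap.mem_range_self f _⟩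
  have h2 : Li ⟨f (Finsupp.single i 1), LinearMap.mem_range_self f _⟩ = w i :=
    (hL _).trans (by simp [hg])
  rw [h2] at h1
  simpa [hi] using h1

/-- Every finite Gram matrix is realized in some `ℂⁿ`. -/
theorem exists_euclideanSpace_inner_eq {E ι : Type*} [NormedAddCommGroup E]
    [InnerProductSpace ℂ E] [Finite ι] (u : ι → E) :
    ∃ (n : ℕ) (w : ι → EuclideanSpace ℂ (Fin n)),
      ∀ i j, inner ℂ (w i) (w j) = inner ℂ (u i) (u j) := by
  have : FiniteDimensional ℂ (Submodule.span ℂ (Set.range u)) :=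
    FiniteDimensional.span_of_finite ℂ (Set.finite_range u)
  let B := stdOrthonormalBasis ℂ (Submodule.span ℂ (Set.range u))
  refine ⟨_, fun i => B.repr ⟨u i, Submodule.subset_span ⟨i, rfl⟩⟩, fun i j => ?_⟩
  rw [LinearIsometryEquiv.inner_map_map, Submodule.coe_inner]

/-! ### The Cauchy kernel and the catalyst vectors. -/

/-- Geometric sequences realize the Cauchy kernel `1 / (s + t)` as a Gram matrix in `ℓ²`. -/
theorem exists_lp_inner_eq_inv_add :
    ∃ g : ℝ → lp (fun _ : ℕ => ℂ) 2, ∀ s ∈ Set.Ioc (0 : ℝ) (1 / 2), ∀ t ∈ Set.Ioc (0 : ℝ) (1 / 2),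
      inner ℂ (g s) (g t) = (((s + t)⁻¹ : ℝ) : ℂ) := by
  -- Cayley transform, chosen so that `(1/2 + s) (1/2 + t) (1 - r s * r t) = s + t`.
  let r : ℝ → ℝ := fun s => (1 / 2 - s) / (1 / 2 + s)
  have hr : ∀ s ∈ Set.Ioc (0 : ℝ) (1 / 2), 0 ≤ r s ∧ r s < 1 := by
    rintro s ⟨h0, h1⟩
    exact ⟨div_nonneg (by linarith) (by linarith), (div_lt_one (by linarith)).2 (by linarith)⟩
  let f : ℝ → ℕ → ℂ := fun s k => ((r s ^ k / (1 / 2 + s) : ℝ) : ℂ)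
  have hf : ∀ s ∈ Set.Ioc (0 : ℝ) (1 / 2), Memℓp (f s) 2 := by
    intro s hs
    refine memℓp_gen ?_
    have h1 : r s * r s < 1 := by nlinarith [hr s hs]
    have : ∀ k, ‖f s k‖ ^ (2 : ENNReal).toReal = (r s * r s) ^ k * ((1 / 2 + s) ^ 2)⁻¹ := by
      intro k
      simp only [f, Complex.norm_real, ENNReal.toReal_ofNat, Real.rpow_ofNat, Real.norm_eq_abs,
        sq_abs, div_pow, mul_pow]
      ring
    simp only [this]
    exact (summable_geometric_of_lt_one (by nlinarith [hr s hs]) h1).mul_right _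
  have hex : ∀ s, ∃ v : lp (fun _ : ℕ => ℂ) 2, s ∈ Set.Ioc (0 : ℝ) (1 / 2) → ∀ k, v k = f s k := by
    intro s
    by_cases h : s ∈ Set.Ioc (0 : ℝ) (1 / 2)
    · exact ⟨⟨_, hf s h⟩, fun _ _ => rfl⟩
    · exact ⟨0, fun h' => absurd h' h⟩
  choose g hg using hex
  refine ⟨g, fun s hs t ht => ?_⟩
  rw [lp.inner_eq_tsum]
  simp only [hg s hs, hg t ht]
  have hst : ∀ k, inner ℂ (f s k) (f t k) =
      (((r s * r t) ^ k * ((1 / 2 + s) * (1 / 2 + t))⁻¹ : ℝ) : ℂ) := by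
    intro k
    simp only [f, RCLike.inner_apply, Complex.conj_ofReal]
    rw [← Complex.ofReal_mul]
    congr 1
    rw [mul_pow, mul_inv]
    ring
  have h1 : r s * r t < 1 := by nlinarith [hr s hs, hr t ht]
  have h0 : 0 ≤ r s * r t := mul_nonneg (hr s hs).1 (hr t ht).1
  simp only [hst]
  rw [← Complex.ofReal_tsum, tsum_mul_right, tsum_geometric_of_lt_one h0 h1]
  congr 1
  obtain ⟨hs0, -⟩ := hs
  obtain ⟨ht0, -⟩ := ht
  have e1 : (1 / 2 + s) ≠ 0 := by positivity
  have e2 : (1 / 2 + t) ≠ 0 := by positivity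
  rw [← mul_inv]
  congr 1
  simp only [r]
  field_simp
  ring

theorem inner_toLp_four {E : Type*} [NormedAddCommGroup E] [InnerProductSpace ℂ E]
    (u₀ u₁ u₂ u₃ w₀ w₁ w₂ w₃ : E) :
    inner ℂ (WithLp.toLp 2 ![u₀, u₁, u₂, u₃] : PiLp 2 (fun _ : Fin 4 => E))
        (WithLp.toLp 2 ![w₀, w₁, w₂, w₃]) =
      inner ℂ u₀ w₀ + inner ℂ u₁ w₁ + inner ℂ u₂ w₂ + inner ℂ u₃ w₃ := by
  simp [PiLp.inner_apply, Fin.sum_univ_four]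

/-- The vectors out of which the catalysts are built. The sign `s x` tells on which side of `1 / 2`
the acceptance probability lies, and `δ x` is its distance from `1 / 2`. -/
theorem exists_catalyst_vectors {X : Type*} [Finite X] (s δ γ : X → ℝ)
    (hs : ∀ x, s x = 1 ∨ s x = -1) (hδ : ∀ x, δ x ∈ Set.Ioc (0 : ℝ) (1 / 2))
    (hγ : ∀ x, γ x ^ 2 = 1 / 4 - δ x ^ 2) :
    ∃ (n : ℕ) (e : EuclideanSpace ℂ (Fin n)) (a b : X → EuclideanSpace ℂ (Fin n)),
      inner ℂ e e = 1 ∧ (∀ x, inner ℂ e (a x) = 0) ∧ (∀ x, inner ℂ e (b x) = 0) ∧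
      (∀ x y, inner ℂ (a x) (b y) =
        ((-((1 - s x * s y) / 2) * (s y * γ y / (2 * (δ x + δ y))) : ℝ) : ℂ)) ∧
      ∀ x, ‖a x‖ ^ 2 + ‖b x‖ ^ 2 = 1 / (4 * δ x) := by
  obtain ⟨g, hg⟩ := exists_lp_inner_eq_inv_add
  have half_mem : (1 / 2 : ℝ) ∈ Set.Ioc (0 : ℝ) (1 / 2) := ⟨by norm_num, le_rfl⟩
  -- Coordinate 0 is reserved for `e`. In coordinates 2 and 3, `a x` and `b y` overlap only if `s x
  -- ≠ s y`. There they contribute `1 / (8 δ)` and `γ² / (2 δ) = 1 / (8 δ) - δ / 2` to the squared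
  -- norms; coordinate 1 pads by the missing `δ / 2`, since `g (1 / 2)` is a unit vector.
  let e : PiLp 2 (fun _ : Fin 4 => lp (fun _ : ℕ => ℂ) 2) := WithLp.toLp 2 ![g (1 / 2), 0, 0, 0]
  let a : X → PiLp 2 (fun _ : Fin 4 => lp (fun _ : ℕ => ℂ) 2) := fun x =>
    WithLp.toLp 2 ![0, ((√(δ x / 2) : ℝ) : ℂ) • g (1 / 2),
    (((1 + s x) / 4 : ℝ) : ℂ) • g (δ x), (((1 - s x) / 4 : ℝ) : ℂ) • g (δ x)]
  let b : X → PiLp 2 (fun _ : Fin 4 => lp (fun _ : ℕ => ℂ) 2) := fun x =>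
    WithLp.toLp 2 ![0, 0,
    ((γ x * (1 - s x) / 2 : ℝ) : ℂ) • g (δ x), ((-γ x * (1 + s x) / 2 : ℝ) : ℂ) • g (δ x)]
  obtain ⟨n, w, hw⟩ := exists_euclideanSpace_inner_eq
    (Sum.elim (fun _ : Unit => e) (Sum.elim a b))
  have hgg : ∀ x y, inner ℂ (g (δ x)) (g (δ y)) = (((δ x + δ y)⁻¹ : ℝ) : ℂ) :=
    fun x y => hg _ (hδ x) _ (hδ y)
  have hg1 : inner ℂ (g (1 / 2)) (g (1 / 2)) = 1 := by
    rw [hg _ half_mem _ half_mem]; norm_num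
  refine ⟨n, w (.inl ()), fun x => w (.inr (.inl x)), fun x => w (.inr (.inr x)), ?_, ?_, ?_, ?_, ?_⟩
  · rw [hw]
    simp only [Sum.elim_inl, e, inner_toLp_four, hg1, inner_zero_left, add_zero]
  · intro x
    rw [hw]
    simp [e, a, inner_toLp_four]
  · intro x
    rw [hw]
    simp [e, b, inner_toLp_four]
  · intro x y
    rw [hw]
    simp only [Sum.elim_inl, Sum.elim_inr, a, b, inner_toLp_four,
      inner_smul_left, inner_smul_right, hgg, Complex.conj_ofReal, 
      inner_zero_right, add_zero, zero_add]
    have hD : δ x + δ y ≠ 0 := (add_pos (hδ x).1 (hδ y).1).ne'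
    norm_cast
    rcases hs x with h | h <;> rcases hs y with h' | h' <;> rw [h, h'] <;> field_simp <;> ring
  · intro x
    have key : ∀ v : EuclideanSpace ℂ (Fin n), ((‖v‖ ^ 2 : ℝ) : ℂ) = inner ℂ v v := fun v => by
      rw [inner_self_eq_norm_sq_to_K]; norm_cast
    have hδx := (hδ x).1
    have hsq : √(δ x / 2) * √(δ x / 2) = δ x / 2 := Real.mul_self_sqrt (by positivity)
    rw [← Complex.ofReal_inj, Complex.ofReal_add, key, key, hw, hw]
    simp only [Sum.elim_inl, Sum.elim_inr, a, b, inner_toLp_four,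
      inner_smul_left, inner_smul_right, hgg, hg1, Complex.conj_ofReal, 
      inner_zero_right, add_zero, zero_add]
    norm_cast
    have hcross : (δ x + δ x)⁻¹ = 1 / (2 * δ x) := by rw [← two_mul, one_div]
    rw [hcross, mul_one, ← mul_assoc, hsq]
    rcases hs x with h | h <;> rw [h] <;> field_simp <;> ring_nf <;> rw [hγ] <;> ring

/-! ### Transducers from Gram matrices. -/

/-- A two-query transducer exists as soon as the Gram matrices of the states before and after
each of its input-independent unitaries agree. -/
theorem exists_transducer_of_inner_eq {M X : Type*} [NormedAddCommGroup M] [InnerProductSpace ℂ M]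
    [FiniteDimensional ℂ M] {a b : ℕ} (O : X → (M ≃ₗᵢ[ℂ] M))
    (ξ τ : X → EuclideanSpace ℂ (Fin a))
    (c σ₀ σ₁ : X → EuclideanSpace ℂ (Fin b) ⊗[ℂ] M) (κ₀ κ₁ : X → EuclideanSpace ℂ (Fin a))
    (h₀ : ∀ x y, inner ℂ (ξ x) (ξ y) + inner ℂ (c x) (c y) =
      inner ℂ (κ₀ x) (κ₀ y) + inner ℂ (σ₀ x) (σ₀ y))
    (h₁ : ∀ x y, inner ℂ (κ₀ x) (κ₀ y) +
        inner ℂ ((O x).lTensor (EuclideanSpace ℂ (Fin b)) (σ₀ x))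
          ((O y).lTensor (EuclideanSpace ℂ (Fin b)) (σ₀ y)) =
      inner ℂ (κ₁ x) (κ₁ y) + inner ℂ (σ₁ x) (σ₁ y))
    (h₂ : ∀ x y, inner ℂ (κ₁ x) (κ₁ y) +
        inner ℂ ((O x).lTensor (EuclideanSpace ℂ (Fin b)) (σ₁ x))
          ((O y).lTensor (EuclideanSpace ℂ (Fin b)) (σ₁ y)) =
      inner ℂ (τ x) (τ y) + inner ℂ (c x) (c y)) :
    ∃ (l : ℕ) (S : Transducer (EuclideanSpace ℂ (Fin a)) (EuclideanSpace ℂ (Fin l))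
        (EuclideanSpace ℂ (Fin a)) (EuclideanSpace ℂ (Fin b)) M),
      ∀ x, ∃ v : EuclideanSpace ℂ (Fin l), S.TransducesWith (O x) (ξ x) (τ x) v ∧
        S.queryComplexity (O x) (ξ x) v = ‖σ₀ x‖ ^ 2 + ‖σ₁ x‖ ^ 2 := by
  -- The private space is the whole queried space, written in coordinates; the public space is never
  -- queried.
  let ι := (stdOrthonormalBasis ℂ (EuclideanSpace ℂ (Fin b) ⊗[ℂ] M)).repr
  have key : ∀ (k k' : X → EuclideanSpace ℂ (Fin a))
      (t t' : X → EuclideanSpace ℂ (Fin b) ⊗[ℂ] M),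
      (∀ x y, inner ℂ (k x) (k y) + inner ℂ (t x) (t y) =
        inner ℂ (k' x) (k' y) + inner ℂ (t' x) (t' y)) →
      ∃ U : WithLp 2 (EuclideanSpace ℂ (Fin a) × EuclideanSpace ℂ (Fin _)) ≃ₗᵢ[ℂ]
          WithLp 2 (EuclideanSpace ℂ (Fin a) × EuclideanSpace ℂ (Fin _)),
        ∀ x, U (WithLp.toLp 2 (k x, ι (t x))) = WithLp.toLp 2 (k' x, ι (t' x)) := by
    intro k k' t t' h
    refine exists_linearIsometryEquiv_of_inner_eq _ _ fun x y => ?_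
    simp only [WithLp.prod_inner_apply, LinearIsometryEquiv.inner_map_map]
    exact h x y
  obtain ⟨U₀, hU₀⟩ := key _ _ _ _ h₀
  obtain ⟨U₁, hU₁⟩ := key _ _ _ _ h₁
  obtain ⟨U₂, hU₂⟩ := key _ _ _ _ h₂
  let S : Transducer (EuclideanSpace ℂ (Fin a)) (EuclideanSpace ℂ (Fin _))
      (EuclideanSpace ℂ (Fin a)) (EuclideanSpace ℂ (Fin b)) M :=
    { decomp := LinearIsometryEquiv.withLpProdCongr 2 (LinearIsometryEquiv.refl ℂ _) ι.symm
      Q := 2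
      U := fun t => if t = 0 then U₀ else if t = 1 then U₁ else U₂ }
  have hquery : ∀ (B : M ≃ₗᵢ[ℂ] M) (k : EuclideanSpace ℂ (Fin a))
      (t : EuclideanSpace ℂ (Fin b) ⊗[ℂ] M),
      QueryAlgorithm.queryOp S B (WithLp.toLp 2 (k, ι t)) =
        WithLp.toLp 2 (k, ι (B.lTensor (EuclideanSpace ℂ (Fin b)) t)) := by
    intro B k t
    change WithLp.toLp 2 (k, ι (B.lTensor (EuclideanSpace ℂ (Fin b)) (ι.symm (ι t)))) = _
    rw [LinearIsometryEquiv.symm_apply_apply]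
  refine ⟨_, S, fun x => ⟨ι (c x), ?_⟩⟩
  have s₀ : QueryAlgorithm.state S (O x) (WithLp.toLp 2 (ξ x, ι (c x))) 0 =
      WithLp.toLp 2 (κ₀ x, ι (σ₀ x)) := hU₀ x
  have s₁ : QueryAlgorithm.state S (O x) (WithLp.toLp 2 (ξ x, ι (c x))) 1 =
      WithLp.toLp 2 (κ₁ x, ι (σ₁ x)) := by
    rw [QueryAlgorithm.state, s₀, hquery]
    exact hU₁ x
  have s₂ : QueryAlgorithm.state S (O x) (WithLp.toLp 2 (ξ x, ι (c x))) 2 =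
      WithLp.toLp 2 (τ x, ι (c x)) := by
    rw [QueryAlgorithm.state, s₁, hquery]
    exact hU₂ x
  refine ⟨s₂, ?_⟩
  have hdecomp : ∀ (k : EuclideanSpace ℂ (Fin a)) (t : EuclideanSpace ℂ (Fin b) ⊗[ℂ] M),
      (S.decomp (WithLp.toLp 2 (k, ι t))).snd = t := fun k t => ι.symm_apply_apply t
  change ∑ t ∈ Finset.range 2, ‖(S.decomp (QueryAlgorithm.state S (O x)
    (WithLp.toLp 2 (ξ x, ι (c x))) t)).snd‖ ^ 2 = _
  rw [Finset.sum_range_succ, Finset.sum_range_one, s₀, s₁, hdecomp, hdecomp]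

/-! ### States for the bidirectional oracle. -/

section Embedding

variable {G N : Type*} [NormedAddCommGroup G] [InnerProductSpace ℂ G]
  [NormedAddCommGroup N] [InnerProductSpace ℂ N]

/-- `g ⊗ m + h ⊗ n`, as a state to be processed by the first part of a bidirectional oracle. -/
def forwardState (g h : G) (m n : N) : G ⊗[ℂ] WithLp 2 (N × N) :=
  g ⊗ₜ WithLp.toLp 2 (m, 0) + h ⊗ₜ WithLp.toLp 2 (n, 0)

/-- `g ⊗ m + h ⊗ n`, as a state to be processed by the second part of a bidirectional oracle. -/
def backwardState (g h : G) (m n : N) : G ⊗[ℂ] WithLp 2 (N × N) :=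
  g ⊗ₜ WithLp.toLp 2 (0, m) + h ⊗ₜ WithLp.toLp 2 (0, n)

theorem lTensor_bidirectional_forwardState (O : N ≃ₗᵢ[ℂ] N) (g h : G) (m n : N) :
    (bidirectional O).lTensor G (forwardState g h m n) = forwardState g h (O m) (O n) := by
  have hb : ∀ m : N, bidirectional O (WithLp.toLp 2 (m, 0)) = WithLp.toLp 2 (O m, 0) := fun m => by
    change WithLp.toLp 2 (O m, O.symm 0) = _
    rw [map_zero]
  simp [forwardState, hb]

theorem lTensor_bidirectional_backwardState (O : N ≃ₗᵢ[ℂ] N) (g h : G) (m n : N) :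
    (bidirectional O).lTensor G (backwardState g h m n) =
      backwardState g h (O.symm m) (O.symm n) := by
  have hb : ∀ m : N, bidirectional O (WithLp.toLp 2 (0, m)) = WithLp.toLp 2 (0, O.symm m) :=
    fun m => by
      change WithLp.toLp 2 (O 0, O.symm m) = _
      rw [map_zero]
  simp [backwardState, hb]

theorem inner_forwardState (g h g' h' : G) (m n m' n' : N) :
    inner ℂ (forwardState g h m n) (forwardState g' h' m' n') =
      inner ℂ g g' * inner ℂ m m' + inner ℂ g h' * inner ℂ m n' +
        (inner ℂ h g' * inner ℂ n m' + inner ℂ h h' * inner ℂ n n') := by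
  simp [forwardState, inner_add_left, inner_add_right, WithLp.prod_inner_apply]
  ring

theorem inner_backwardState (g h g' h' : G) (m n m' n' : N) :
    inner ℂ (backwardState g h m n) (backwardState g' h' m' n') =
      inner ℂ g g' * inner ℂ m m' + inner ℂ g h' * inner ℂ m n' +
        (inner ℂ h g' * inner ℂ n m' + inner ℂ h h' * inner ℂ n n') := by
  simp [backwardState, inner_add_left, inner_add_right, WithLp.prod_inner_apply]
  ring

theorem norm_sq_forwardState (g h : G) (m n : N) :
    ((‖forwardState g h m n‖ ^ 2 : ℝ) : ℂ) =
      inner ℂ g g * inner ℂ m m + inner ℂ g h * inner ℂ m n +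
        (inner ℂ h g * inner ℂ n m + inner ℂ h h * inner ℂ n n) := by
  rw [← inner_forwardState, Complex.ofReal_pow]
  exact (inner_self_eq_norm_sq_to_K (𝕜 := ℂ) (forwardState g h m n)).symm

theorem norm_sq_backwardState (g h : G) (m n : N) :
    ((‖backwardState g h m n‖ ^ 2 : ℝ) : ℂ) =
      inner ℂ g g * inner ℂ m m + inner ℂ g h * inner ℂ m n +
        (inner ℂ h g * inner ℂ n m + inner ℂ h h * inner ℂ n n) := by
  rw [← inner_backwardState, Complex.ofReal_pow]
  exact (inner_self_eq_norm_sq_to_K (𝕜 := ℂ) (backwardState g h m n)).symm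

end Embedding

/-! ### Inner products of two-branch states. -/

theorem inner_ket (i j : Fin 2) : inner ℂ (ket i) (ket j) = if i = j then 1 else 0 := by
  simp [ket, EuclideanSpace.inner_single_left]

theorem inner_ofReal_smul_add_smul {E : Type*} [NormedAddCommGroup E] [InnerProductSpace ℂ E]
    (c d c' d' : ℝ) (u v u' v' : E) :
    inner ℂ ((c : ℂ) • u + (d : ℂ) • v) ((c' : ℂ) • u' + (d' : ℂ) • v') =
      c * c' * inner ℂ u u' + c * d' * inner ℂ u v' +
        (d * c' * inner ℂ v u' + d * d' * inner ℂ v v') := by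
  simp only [inner_add_left, inner_add_right, inner_smul_left, inner_smul_right,
    Complex.conj_ofReal]
  ring

/-- The state `c |0⟩ u + d |1⟩ v`. -/
noncomputable def branchState {W : Type*} [NormedAddCommGroup W] [InnerProductSpace ℂ W] (c d : ℝ) (u v : W) :
    Qubit ⊗[ℂ] W :=
  (c : ℂ) • (ket 0 ⊗ₜ[ℂ] u) + (d : ℂ) • (ket 1 ⊗ₜ[ℂ] v)

theorem inner_branchState {W : Type*} [NormedAddCommGroup W] [InnerProductSpace ℂ W]
    (c d c' d' : ℝ) (u v u' v' : W) :
    inner ℂ (branchState c d u v) (branchState c' d' u' v') =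
      c * c' * inner ℂ u u' + d * d' * inner ℂ v v' := by
  refine (inner_ofReal_smul_add_smul (E := Qubit ⊗[ℂ] W) _ _ _ _ _ _ _ _).trans ?_
  simp only [TensorProduct.inner_tmul, inner_ket]
  norm_num

/-! ### The two-query transducer. -/

theorem corollary4p6
    {W : Type*} [NormedAddCommGroup W] [InnerProductSpace ℂ W] [FiniteDimensional ℂ W]
    (w₀ : W) (hw₀ : ‖w₀‖ = 1)
    {X : Type*} [Finite X]
    (p : X → ℝ) (hp₀ : ∀ x, 0 ≤ p x) (hp₁ : ∀ x, p x ≤ 1) (hp : ∀ x, p x ≠ 1 / 2)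
    (φ₀ φ₁ : X → W) (hφ₀ : ∀ x, ‖φ₀ x‖ = 1) (hφ₁ : ∀ x, ‖φ₁ x‖ = 1)
    (O : X → ((Qubit ⊗[ℂ] W) ≃ₗᵢ[ℂ] (Qubit ⊗[ℂ] W)))
    (hO : ∀ x, O x (ket 0 ⊗ₜ[ℂ] w₀) =
      (Real.sqrt (1 - p x) : ℂ) • (ket 0 ⊗ₜ[ℂ] φ₀ x) +
        (Real.sqrt (p x) : ℂ) • (ket 1 ⊗ₜ[ℂ] φ₁ x)) :
    ∃ (l a b : ℕ)
      (S : Transducer Qubit (EuclideanSpace ℂ (Fin l))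
        (EuclideanSpace ℂ (Fin a)) (EuclideanSpace ℂ (Fin b))
        (WithLp 2 ((Qubit ⊗[ℂ] W) × (Qubit ⊗[ℂ] W)))),
      ∀ x, ∃ v : EuclideanSpace ℂ (Fin l),
        S.TransducesWith (bidirectional (O x)) (ket 0)
            (if p x < 1 / 2 then ket 0 else ket 1) v ∧
          S.queryComplexity (bidirectional (O x)) (ket 0) v = 1 + 1 / (2 * |1 / 2 - p x|) := by
  let s : X → ℝ := fun x => if p x < 1 / 2 then 1 else -1
  let δ : X → ℝ := fun x => |1 / 2 - p x|
  let α : X → ℝ := fun x => √(1 - p x)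
  let β : X → ℝ := fun x => √(p x)
  have hα : ∀ x, α x ^ 2 = 1 - p x := fun x => Real.sq_sqrt (by linarith [hp₁ x])
  have hβ : ∀ x, β x ^ 2 = p x := fun x => Real.sq_sqrt (hp₀ x)
  have hs : ∀ x, s x = 1 ∨ s x = -1 := fun x => by
    by_cases h : p x < 1 / 2
    · exact .inl (if_pos h)
    · exact .inr (if_neg h)
  have hδ : ∀ x, δ x ∈ Set.Ioc (0 : ℝ) (1 / 2) := fun x =>
    ⟨abs_pos.2 (sub_ne_zero.2 (hp x).symm),
      abs_le.2 ⟨by linarith [hp₁ x], by linarith [hp₀ x]⟩⟩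
  have hsδ : ∀ x, p x = 1 / 2 - s x * δ x := fun x => by
    by_cases h : p x < 1 / 2
    · simp only [s, δ, if_pos h, abs_of_pos (sub_pos.2 h)]; ring
    · simp only [s, δ, if_neg h, abs_of_nonpos (sub_nonpos.2 (not_lt.1 h))]; ring
  have hγ : ∀ x, (α x * β x) ^ 2 = 1 / 4 - δ x ^ 2 := fun x => by
    rw [mul_pow, hα, hβ, hsδ x]
    rcases hs x with h | h <;> rw [h] <;> ring
  obtain ⟨b, e, f, g, hee, hef, heg, hfg, hnorm⟩ :=
    exists_catalyst_vectors s δ (fun x => α x * β x) hs hδ hγ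
  let F : X → X → ℝ := fun x y =>
    -((1 - s x * s y) / 2) * (s y * (α y * β y) / (2 * (δ x + δ y)))
  replace hfg : ∀ x y, inner ℂ (f x) (g y) = (F x y : ℂ) := hfg
  have hgf : ∀ x y, inner ℂ (g x) (f y) = (F y x : ℂ) := fun x y => by
    rw [← inner_conj_symm, hfg, Complex.conj_ofReal]
  -- `hF₀` and `hF₁` compare the coefficients of `⟨φ₀ x, φ₀ y⟩` and `⟨φ₁ x, φ₁ y⟩` in the Gram
  -- condition for the middle unitary. On opposite sides of `1/2` both reduce to `|p x - p y| = δ x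
  -- + δ y`.
  have hF₀ : ∀ x y, (1 - s x * s y) / 2 * (α x * α y) =
      2 * (F x y * (α x * β y) + F y x * (β x * α y)) := fun x y => by
    have hD : δ x + δ y ≠ 0 := (add_pos (hδ x).1 (hδ y).1).ne'
    have hx := (hβ x).trans (hsδ x)
    have hy := (hβ y).trans (hsδ y)
    simp only [F, add_comm (δ y) (δ x)]
    rcases hs x with h | h <;> rcases hs y with h' | h' <;> rw [h] at hx ⊢ <;> rw [h'] at hy ⊢
    · ring
    · field_simp
      linear_combination α x * α y * (hx - hy)
    · field_simp
      linear_combination α x * α y * (hy - hx)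
    · ring
  have hF₁ : ∀ x y, (1 - s x * s y) / 2 * (β x * β y) =
      -2 * (F x y * (β x * α y) + F y x * (α x * β y)) := fun x y => by
    have hD : δ x + δ y ≠ 0 := (add_pos (hδ x).1 (hδ y).1).ne'
    have hx := hα x
    have hy := hα y
    rw [hsδ x] at hx
    rw [hsδ y] at hy
    simp only [F, add_comm (δ y) (δ x)]
    rcases hs x with h | h <;> rcases hs y with h' | h' <;> rw [h] at hx ⊢ <;> rw [h'] at hy ⊢
    · ring
    · field_simp
      linear_combination β x * β y * (hy - hx)
    · field_simp
      linear_combination β x * β y * (hx - hy)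
    · ring
  have hfe : ∀ x, inner ℂ (f x) e = 0 := fun x => inner_eq_zero_symm.1 (hef x)
  have hge : ∀ x, inner ℂ (g x) e = 0 := fun x => inner_eq_zero_symm.1 (heg x)
  let r : ℝ := √(1 / 2)
  have hr : r * r = 1 / 2 := Real.mul_self_sqrt (by norm_num)
  -- The parameter `t` is the sign carried by `e`: `1` before the middle unitary, `s x` after it.
  let d : X → ℝ → EuclideanSpace ℂ (Fin b) := fun x t => ((t * r : ℝ) : ℂ) • e + f x
  have hdd : ∀ x y t t', inner ℂ (d x t) (d y t') =
      ((t * t' / 2 : ℝ) : ℂ) + inner ℂ (f x) (f y) := fun x y t t' => by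
    simp only [d, inner_add_left, inner_add_right, inner_smul_left, inner_smul_right, hee, hef, hfe,
      Complex.conj_ofReal, mul_zero, add_zero, zero_add, mul_one]
    rw [← Complex.ofReal_mul, mul_mul_mul_comm, hr]
    congr 2
    ring
  have hdg : ∀ x y t, inner ℂ (d x t) (g y) = inner ℂ (f x) (g y) := fun x y t => by
    simp [d, heg]
  have hgd : ∀ x y t, inner ℂ (g x) (d y t) = inner ℂ (g x) (f y) := fun x y t => by
    simp [d, hge]
  let z : Qubit ⊗[ℂ] W := ket 0 ⊗ₜ[ℂ] w₀
  let ψ : X → Qubit ⊗[ℂ] W := fun x => branchState (α x) (β x) (φ₀ x) (φ₁ x)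
  let ω : X → Qubit ⊗[ℂ] W := fun x => branchState (β x) (-α x) (φ₀ x) (φ₁ x)
  let χ : X → Qubit ⊗[ℂ] W := fun x => (O x).symm (ω x)
  have hOz : ∀ x, O x z = ψ x := hO
  have hOψ : ∀ x, (O x).symm (ψ x) = z := fun x => by
    rw [← hOz, LinearIsometryEquiv.symm_apply_apply]
  have hOχ : ∀ x, O x (χ x) = ω x := fun x => (O x).apply_symm_apply (ω x)
  have unit_inner : ∀ w : W, ‖w‖ = 1 → inner ℂ w w = 1 := fun w hw => by
    rw [inner_self_eq_norm_sq_to_K, hw]; simp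
  have hzz : inner ℂ z z = 1 := by
    simp only [z, TensorProduct.inner_tmul, inner_ket, unit_inner w₀ hw₀]
    simp
  have swap : ∀ u v : Qubit ⊗[ℂ] W, inner ℂ u v = 0 → inner ℂ v u = 0 := fun u v =>
    (inner_eq_zero_symm (𝕜 := ℂ) (E := Qubit ⊗[ℂ] W)).1
  have hψω : ∀ x, inner ℂ (ψ x) (ω x) = 0 := fun x => by
    simp only [ψ, ω, inner_branchState, unit_inner _ (hφ₀ x), unit_inner _ (hφ₁ x)]
    push_cast
    ring
  have hzχ : ∀ x, inner ℂ z (χ x) = 0 := fun x => by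
    rw [← (O x).inner_map_map, hOz, hOχ, hψω]
  have hχz : ∀ x, inner ℂ (χ x) z = 0 := fun x => swap _ _ (hzχ x)
  have hαβ : ∀ x, (α x : ℂ) * α x + β x * β x = 1 := fun x => by
    norm_cast
    linarith [hα x, hβ x, sq (α x), sq (β x)]
  have hψψ : ∀ x, inner ℂ (ψ x) (ψ x) = 1 := fun x => by
    rw [← hOz, (O x).inner_map_map, hzz]
  have hωω : ∀ x, inner ℂ (ω x) (ω x) = 1 := fun x => by
    simp only [ω, inner_branchState, unit_inner _ (hφ₀ x), unit_inner _ (hφ₁ x)]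
    push_cast
    linear_combination hαβ x
  have hχχ : ∀ x, inner ℂ (χ x) (χ x) = 1 := fun x => by
    rw [← hωω x]
    exact (O x).symm.inner_map_map _ _
  have hωψ : ∀ x, inner ℂ (ω x) (ψ x) = 0 := fun x => swap _ _ (hψω x)
  have hkk : inner ℂ ((r : ℂ) • ket 0) ((r : ℂ) • ket 0) = (1 / 2 : ℂ) := by
    rw [inner_smul_left, inner_smul_right, inner_ket, Complex.conj_ofReal, if_pos rfl, mul_one,
      ← Complex.ofReal_mul, hr]
    norm_num
  obtain ⟨l, S, hS⟩ := exists_transducer_of_inner_eq (fun x => bidirectional (O x))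
    (fun _ => ket 0) (fun x => if p x < 1 / 2 then ket 0 else ket 1)
    (fun x => forwardState (f x) (-g x) z (χ x))
    (fun x => forwardState (d x 1) (-g x) z (χ x))
    (fun x => backwardState (d x (s x)) (g x) (ψ x) (ω x))
    (fun _ => (r : ℂ) • ket 0) (fun _ => (r : ℂ) • ket 0)
    (fun x y => by
      simp only [inner_forwardState, hzz, hzχ, hχz, hkk, hdd, inner_ket, if_true]
      push_cast
      ring)
    (fun x y => by
      simp only [lTensor_bidirectional_forwardState, inner_forwardState, inner_backwardState, hOz,
        hOχ, hkk, hdd, hdg, hgd, inner_neg_left, inner_neg_right, hfg, hgf]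
      simp only [ψ, ω, inner_branchState]
      have h₀ := congrArg Complex.ofReal (hF₀ x y)
      have h₁ := congrArg Complex.ofReal (hF₁ x y)
      push_cast at h₀ h₁ ⊢
      linear_combination inner ℂ (φ₀ x) (φ₀ y) * h₀ + inner ℂ (φ₁ x) (φ₁ y) * h₁)
    -- Flipping the sign of every `g x` leaves the Gram matrix unchanged, because `z` is orthogonal
    -- to every `χ x`; so only the phases `s x` have to be matched with the outputs.
    (fun x y => by
      simp only [lTensor_bidirectional_backwardState, inner_forwardState, inner_backwardState, hOψ,
        hzz, hkk, hdd, inner_neg_left, inner_neg_right]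
      change _ + (_ * _ + _ * inner ℂ z (χ y) + (_ * inner ℂ (χ x) z + _ * inner ℂ (χ x) (χ y))) = _
      have hτ : inner ℂ (if p x < 1 / 2 then ket 0 else ket 1)
          (if p y < 1 / 2 then ket 0 else ket 1) = (1 / 2 + s x * s y / 2 : ℂ) := by
        by_cases hx : p x < 1 / 2 <;> by_cases hy : p y < 1 / 2 <;>
          simp only [s, hx, hy, inner_ket, if_true, if_false] <;> norm_num
      rw [hτ, hzχ, hχz]
      push_cast
      ring)
  refine ⟨l, 2, b, S, fun x => ?_⟩
  obtain ⟨v, hv, hq⟩ := hS x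
  refine ⟨v, hv, hq.trans ?_⟩
  have hnorm' : inner ℂ (f x) (f x) + inner ℂ (g x) (g x) = ((1 / (4 * δ x) : ℝ) : ℂ) := by
    rw [← hnorm, inner_self_eq_norm_sq_to_K, inner_self_eq_norm_sq_to_K]
    norm_cast
  have hss : s x * s x = 1 := by rcases hs x with h | h <;> rw [h] <;> norm_num
  rw [← Complex.ofReal_inj, Complex.ofReal_add, norm_sq_forwardState, norm_sq_backwardState]
  simp only [hdd, hzz, hzχ, hχz, hχχ, hψψ, hωω, hψω, hωψ,
    inner_neg_left, inner_neg_right, hss]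
  have hδ' : 1 / (2 * δ x) = 2 * (1 / (4 * δ x)) := by
    have := (hδ x).1
    field_simp
    norm_num
  change _ = ((1 + 1 / (2 * δ x) : ℝ) : ℂ)
  rw [hδ', Complex.ofReal_add, Complex.ofReal_mul, ← hnorm']
  push_cast
  ring
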